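/- Let $G$ be a finite soluble group and let $k\ge 0$ be an integer. The words $\delta_k=\delta_k(x_1,\dots,x_{2^k})$ are defined by $\delta_0=x_1$ and $\delta_k=[\delta_{k-1}(x_1,\dots,x_{2^{k-1}}),\,\delta_{k-1}(x_{2^{k-1}+1},\dots,x_{2^k})]$ for $k\ge1$, where $[x,y]=xyx^{-1}y^{-1}$ (the convention $[x,y]=x^{-1}y^{-1}xy$ gives the same set of values in every group). A $\delta_k$-value in $G$ is an element of the form $\delta_k(g_1,\dots,g_{2^k})$ with $g_1,\dots,g_{2^k}\in G$. Let $G^{(k)}$ be the $k$-th term of the derived series of $G$ (so $G^{(0)}=G$ and $G^{(k)}=[G^{(k-1)},G^{(k-1)}]$ for $k\ge 1$), and let $|x|$ denote the order of an element $x$. Then $G^{(k)}$ is nilpotent if and only if $|ab|=|a||b|$ for all $\delta_k$-values $a,b\in G$ of coprime orders. -/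

import Mathlib

open scoped commutatorElement

/-- The word `δ_k` in `2 ^ k` variables, evaluated at a tuple `x` of elements of `G`:
`δ_0 = x_1` and `δ_{k+1}` is the commutator of `δ_k` at the first half of the tuple
with `δ_k` at the second half. -/
def deltaWord {G : Type*} [Group G] : (k : ℕ) → (Fin (2 ^ k) → G) → G
  | 0, x => x 0
  | k + 1, x =>
    ⁅deltaWord k (fun i => x ⟨i.val, by have := i.isLt; rw [pow_succ]; omega⟩),
      deltaWord k (fun i => x ⟨2 ^ k + i.val, by have := i.isLt; rw [pow_succ]; omega⟩)⁆

/-- `g` is a `δ_k`-value in `G`. -/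
def IsDeltaValue {G : Type*} [Group G] (k : ℕ) (g : G) : Prop :=
  ∃ x : Fin (2 ^ k) → G, deltaWord k x = g

/-!
If `G^(k)` is nilpotent, elements of coprime orders in it commute, so their orders multiply.

For the converse, there are two ingredients.

* In a finite soluble group, `G^(k)` is generated by the `δ_k`-values of prime power order
  (`derivedSeries_le_closure_isDeltaValue_primePow`). Outside the Frattini subgroup there is a
  normal `q`-subgroup `Q`, so `G = Q H` with `H` proper. Because `δ_k` is multilinear as a
  commutator word, each of its values on `G` is a value on `H` up to a product of values lying in
  `Q` (`IsDeltaValue.exists_mul_of_sup_eq_top`); the latter are `q`-elements, and `H` is covered by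
  induction.
* Under the order condition, a `δ_k`-value `x` centralizes every normal subgroup `L` of order
  coprime to that of `x` (`IsDeltaValue.commute_of_coprime`). For `n ∈ L` the iterated commutator
  `y = [n, x, …, x]` with `k + 1` entries `x` is again a `δ_k`-value, and `y x` is conjugate to
  `x`, so `|y| |x| = |x|` and `y = 1`. The entries `x` are then stripped off one at a time.

Induction on `|G|`, applied to `G'`, makes `G^(k+1)` nilpotent. By the second ingredient a
`δ_k`-value `x` of `p`-power order centralizes the Sylow `q`-subgroups of `G^(k+1)` for `q ≠ p`, and
comparing orders once more puts `[G^(k), x]` inside its Sylow `p`-subgroup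
(`commutatorElement_mem_sylow_of_isDeltaValue`). Hence these values generate a normal `p`-subgroup
of `G`, and by the first ingredient `G^(k)` is the join of these subgroups over all primes `p`.
-/

/-! ### `δ_k`-values -/

section DeltaValues

variable {G : Type*} [Group G]

theorem isDeltaValue_zero (g : G) : IsDeltaValue 0 g := ⟨fun _ => g, rfl⟩

theorem isDeltaValue_succ {k : ℕ} {g : G} :
    IsDeltaValue (k + 1) g ↔ ∃ a b : G, IsDeltaValue k a ∧ IsDeltaValue k b ∧ ⁅a, b⁆ = g := by
  constructor
  · rintro ⟨x, rfl⟩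
    exact ⟨_, _, ⟨_, rfl⟩, ⟨_, rfl⟩, rfl⟩
  · rintro ⟨_, _, ⟨x, rfl⟩, ⟨y, rfl⟩, rfl⟩
    refine ⟨fun i => if h : i.val < 2 ^ k then x ⟨i.val, h⟩ else
      y ⟨i.val - 2 ^ k, by have := i.isLt; have := pow_succ 2 k; omega⟩, ?_⟩
    simp [deltaWord]

theorem IsDeltaValue.commutatorElement {k : ℕ} {a b : G} (ha : IsDeltaValue k a)
    (hb : IsDeltaValue k b) : IsDeltaValue (k + 1) ⁅a, b⁆ :=
  isDeltaValue_succ.2 ⟨a, b, ha, hb, rfl⟩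

theorem IsDeltaValue.of_succ {k : ℕ} {g : G} (hg : IsDeltaValue (k + 1) g) :
    IsDeltaValue k g := by
  induction k generalizing g with
  | zero => exact isDeltaValue_zero g
  | succ k ih =>
    obtain ⟨a, b, ha, hb, rfl⟩ := isDeltaValue_succ.1 hg
    exact (ih ha).commutatorElement (ih hb)

theorem IsDeltaValue.of_le {j k : ℕ} (hjk : j ≤ k) {g : G} (hg : IsDeltaValue k g) :
    IsDeltaValue j g := by
  induction hjk with
  | refl => exact hg
  | step _ ih => exact ih hg.of_succ

theorem IsDeltaValue.map {H : Type*} [Group H] (f : G →* H) {k : ℕ} {g : G}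
    (hg : IsDeltaValue k g) : IsDeltaValue k (f g) := by
  induction k generalizing g with
  | zero => exact isDeltaValue_zero _
  | succ k ih =>
    obtain ⟨a, b, ha, hb, rfl⟩ := isDeltaValue_succ.1 hg
    rw [map_commutatorElement]
    exact (ih ha).commutatorElement (ih hb)

theorem IsDeltaValue.conj {k : ℕ} {g : G} (hg : IsDeltaValue k g) (n : G) :
    IsDeltaValue k (n * g * n⁻¹) := by
  simpa using hg.map (MulAut.conj n).toMonoidHom

theorem IsDeltaValue.mem_derivedSeries {k : ℕ} {g : G} (hg : IsDeltaValue k g) :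
    g ∈ derivedSeries G k := by
  induction k generalizing g with
  | zero => simp
  | succ k ih =>
    obtain ⟨a, b, ha, hb, rfl⟩ := isDeltaValue_succ.1 hg
    rw [derivedSeries_succ]
    exact Subgroup.commutator_mem_commutator (ih ha) (ih hb)

theorem normal_closure_of_conj_mem {s : Set G} (hs : ∀ x ∈ s, ∀ g : G, g * x * g⁻¹ ∈ s) :
    (Subgroup.closure s).Normal := by
  have h : Group.conjugatesOfSet s = s := by
    refine subset_antisymm (fun y hy => ?_) Group.subset_conjugatesOfSet
    obtain ⟨x, hx, hxy⟩ := Group.mem_conjugatesOfSet_iff.1 hy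
    obtain ⟨c, rfl⟩ := isConj_iff.1 hxy
    exact hs x hx c
  have : Subgroup.normalClosure s = Subgroup.closure s := by
    rw [Subgroup.normalClosure, h]
  rw [← this]
  exact Subgroup.normalClosure_normal

/-- Modulo a normal subgroup, commuting of generators passes to the generated subgroups. -/
theorem commutatorElement_mem_of_mem_closure {E : Subgroup G} [E.Normal] {s t : Set G}
    (h : ∀ a ∈ s, ∀ b ∈ t, ⁅a, b⁆ ∈ E) {a b : G} (ha : a ∈ Subgroup.closure s)
    (hb : b ∈ Subgroup.closure t) : ⁅a, b⁆ ∈ E := by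
  have key : ∀ x y : G, ⁅x, y⁆ ∈ E ↔ Commute (x : G ⧸ E) (y : G ⧸ E) := fun x y => by
    rw [← QuotientGroup.eq_one_iff, ← commutatorElement_eq_one_iff_commute]
    exact Iff.rfl
  rw [key]
  have h1 : ∀ x ∈ s, Commute (x : G ⧸ E) (b : G ⧸ E) := fun x hx => by
    have : Subgroup.closure t ≤
        (Subgroup.centralizer {(x : G ⧸ E)}).comap (QuotientGroup.mk' E) := by
      rw [Subgroup.closure_le]
      intro y hy
      simpa [Subgroup.mem_centralizer_singleton_iff] using ((key x y).1 (h x hx y hy)).symm.eq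
    have := this hb
    simp only [Subgroup.mem_comap, Subgroup.mem_centralizer_singleton_iff] at this
    exact Commute.symm this
  have : Subgroup.closure s ≤
      (Subgroup.centralizer {(b : G ⧸ E)}).comap (QuotientGroup.mk' E) := by
    rw [Subgroup.closure_le]
    intro y hy
    simpa [Subgroup.mem_centralizer_singleton_iff] using (h1 y hy).eq
  have := this ha
  rwa [Subgroup.mem_comap, Subgroup.mem_centralizer_singleton_iff] at this

theorem closure_isDeltaValue (k : ℕ) :
    Subgroup.closure {g : G | IsDeltaValue k g} = derivedSeries G k := by
  refine le_antisymm ((Subgroup.closure_le _).2 fun g hg => IsDeltaValue.mem_derivedSeries hg) ?_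
  induction k with
  | zero => exact fun g _ => Subgroup.subset_closure (isDeltaValue_zero g)
  | succ k ih =>
    have := normal_closure_of_conj_mem (G := G) (s := {g : G | IsDeltaValue (k + 1) g})
      fun x hx g => IsDeltaValue.conj hx g
    rw [derivedSeries_succ, Subgroup.commutator_le]
    intro a ha b hb
    exact commutatorElement_mem_of_mem_closure
      (fun x hx y hy => Subgroup.subset_closure (IsDeltaValue.commutatorElement hx hy))
      (ih ha) (ih hb)

theorem commutatorElement_mul_left_of_commute {m x z : G} (hx : Commute m x) (hz : Commute m z) :
    ⁅m * x, z⁆ = ⁅x, z⁆ := by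
  have h : Commute m (x * z * x⁻¹) := (hx.mul_right hz).mul_right hx.inv_right
  calc m * x * z * (m * x)⁻¹ * z⁻¹ = m * (x * z * x⁻¹) * m⁻¹ * z⁻¹ := by group
    _ = x * z * x⁻¹ * z⁻¹ := by rw [h.eq, mul_inv_cancel_right]

theorem commutatorElement_mul_right_of_commute {n x z : G} (hx : Commute n x)
    (hz : Commute n z) : ⁅x, n * z⁆ = ⁅x, z⁆ := by
  rw [← commutatorElement_inv, commutatorElement_mul_left_of_commute hz hx, commutatorElement_inv]

/-- The effect on a `δ_k`-value of multiplying the entries by elements of a normal subgroup `F`: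
if `G = F H`, then each `δ_k`-value of `G` agrees with a `δ_k`-value of `H` up to a factor
generated by the `δ_k`-values that lie in `F`. -/
theorem IsDeltaValue.exists_mul_of_sup_eq_top {F H : Subgroup G} [F.Normal] (hFH : F ⊔ H = ⊤)
    {k : ℕ} {g : G} (hg : IsDeltaValue k g) :
    ∃ e ∈ Subgroup.closure {x : G | x ∈ F ∧ IsDeltaValue k x}, ∃ h : H,
      IsDeltaValue k h ∧ g = e * h := by
  induction k generalizing g with
  | zero =>
    obtain ⟨f, hf, h, hh, rfl⟩ := Subgroup.mem_sup_of_normal_left.1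
      (hFH.symm ▸ Subgroup.mem_top g : g ∈ F ⊔ H)
    exact ⟨f, Subgroup.subset_closure ⟨hf, isDeltaValue_zero f⟩, ⟨h, hh⟩, isDeltaValue_zero _, rfl⟩
  | succ k ih =>
    obtain ⟨a, b, ha, hb, rfl⟩ := isDeltaValue_succ.1 hg
    obtain ⟨m, hm, x, hx, rfl⟩ := ih ha
    obtain ⟨n, hn, y, hy, rfl⟩ := ih hb
    set E := Subgroup.closure {x : G | x ∈ F ∧ IsDeltaValue (k + 1) x} with hE
    have : E.Normal := normal_closure_of_conj_mem fun z hz g =>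
      ⟨‹F.Normal›.conj_mem z hz.1 g, hz.2.conj g⟩
    -- The `δ_k`-values in `F` commute with all `δ_k`-values modulo `E`.
    have hcomm : ∀ u ∈ Subgroup.closure {x : G | x ∈ F ∧ IsDeltaValue k x},
        ∀ v : G, IsDeltaValue k v → Commute (u : G ⧸ E) (v : G ⧸ E) := fun u hu v hv => by
      rw [← commutatorElement_eq_one_iff_commute]
      refine (QuotientGroup.eq_one_iff (N := E) ⁅u, v⁆).2 ?_
      refine commutatorElement_mem_of_mem_closure (t := {v}) ?_ hu
        (Subgroup.subset_closure rfl)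
      rintro c ⟨hcF, hc⟩ w rfl
      refine Subgroup.subset_closure ⟨?_, hc.commutatorElement hv⟩
      rw [commutatorElement_def, mul_assoc, mul_assoc, ← mul_assoc w]
      exact F.mul_mem hcF (‹F.Normal›.conj_mem _ (F.inv_mem hcF) w)
    refine ⟨⁅m * x, n * y⁆ * ⁅(x : G), (y : G)⁆⁻¹, ?_, ⁅x, y⁆, hx.commutatorElement hy, ?_⟩
    · have hx' : IsDeltaValue k (x : G) := hx.map H.subtype
      have hy' : IsDeltaValue k (y : G) := hy.map H.subtype
      have h1 := commutatorElement_mul_left_of_commute (hcomm m hm _ hx') (hcomm m hm _ hb)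
      have h2 := commutatorElement_mul_right_of_commute (hcomm n hn _ hx') (hcomm n hn _ hy')
      have h3 : QuotientGroup.mk' E ⁅m * x, n * y⁆ = QuotientGroup.mk' E ⁅(x : G), (y : G)⁆ := by
        rw [map_commutatorElement, map_commutatorElement, map_mul]
        exact h1.trans h2
      rw [← QuotientGroup.eq_one_iff]
      change QuotientGroup.mk' E _ = 1
      rw [map_mul, map_inv, h3, mul_inv_cancel]
    · exact (inv_mul_cancel_right _ _).symm

end DeltaValues

/-! ### Generation by prime power values in soluble groups -/

theorem exists_normal_isPGroup_ne_bot {G : Type*} [Group G] [Finite G] [Group.IsSolvable G]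
    [Nontrivial G] :
    ∃ (q : ℕ) (_ : q.Prime) (Q : Subgroup G), Q.Normal ∧ IsPGroup q Q ∧ Q ≠ ⊥ := by
  classical
  have hsol : ∃ n, derivedSeries G n = ⊥ := (Group.isSolvable_def G).1 inferInstance
  -- The last nontrivial term of the derived series is abelian.
  obtain ⟨n, hn⟩ : ∃ n, Nat.find hsol = n + 1 := by
    refine Nat.exists_eq_succ_of_ne_zero fun h => ?_
    have := Nat.find_spec hsol
    rw [h, derivedSeries_zero] at this
    exact top_ne_bot this
  set A := derivedSeries G n with hA
  have hA1 : A ≠ ⊥ := Nat.find_min hsol (by omega)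
  have hA2 : ⁅A, A⁆ = ⊥ := by rw [hA, ← derivedSeries_succ, ← hn]; exact Nat.find_spec hsol
  have hAcomm : ∀ a ∈ A, ∀ b ∈ A, b * a = a * b := fun a ha b hb => by
    have := Subgroup.commutator_mem_commutator ha hb
    rw [hA2, Subgroup.mem_bot, commutatorElement_eq_one_iff_commute] at this
    exact this.eq.symm
  have hcard : Nat.card A ≠ 1 := by rwa [Ne, Subgroup.card_eq_one]
  obtain ⟨q, hq, hqA⟩ := Nat.exists_prime_and_dvd hcard
  have : Fact q.Prime := ⟨hq⟩
  obtain ⟨S⟩ : Nonempty (Sylow q A) := inferInstance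
  have hSn : (S : Subgroup A).Normal := ⟨fun s hs g => by
    have : g * s * g⁻¹ = s := Subtype.ext (by simp [hAcomm s.1 s.2 g.1 g.2])
    rwa [this]⟩
  have hSc := S.characteristic_of_normal hSn
  refine ⟨q, hq, (S : Subgroup A).map A.subtype, inferInstance, S.isPGroup'.map _, ?_⟩
  rw [Ne, Subgroup.map_eq_bot_iff_of_injective _ A.subtype_injective]
  exact S.ne_bot_of_dvd_card hqA

/-- A nontrivial finite soluble group has a normal `q`-subgroup outside its Frattini subgroup,
hence one with a proper supplement. -/
theorem exists_normal_isPGroup_sup_eq_top {G : Type*} [Group G] [Finite G] [Group.IsSolvable G]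
    [Nontrivial G] :
    ∃ (q : ℕ) (_ : q.Prime) (Q H : Subgroup G), Q.Normal ∧ IsPGroup q Q ∧ H ≠ ⊤ ∧ Q ⊔ H = ⊤ := by
  set π := QuotientGroup.mk' (frattini G) with hπ
  have hfr : frattini G ≠ ⊤ := fun h =>
    bot_ne_top (frattini_nongenerating (K := (⊥ : Subgroup G)) (by rw [h, bot_sup_eq]))
  have : Nontrivial (G ⧸ frattini G) := QuotientGroup.nontrivial_iff.2 hfr
  have : Group.IsSolvable (G ⧸ frattini G) :=
    Group.isSolvable_of_surjective (QuotientGroup.mk'_surjective (frattini G))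
  obtain ⟨q, hq, A, hA, hAq, hA1⟩ := exists_normal_isPGroup_ne_bot (G := G ⧸ frattini G)
  have : Fact q.Prime := ⟨hq⟩
  set M := A.comap π with hM
  have : M.Normal := hA.comap π
  obtain ⟨Q₀⟩ : Nonempty (Sylow q M) := inferInstance
  set Q := (Q₀ : Subgroup M).map M.subtype with hQ
  -- The image of the Sylow subgroup `Q` of `M` is Sylow in the `q`-group `A`, so it is all of `A`.
  have hQA : Q.map π = A := by
    have hf : Function.Surjective (π.subgroupComap A) :=
      π.subgroupComap_surjective_of_surjective A (QuotientGroup.mk'_surjective _)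
    have h1 : ((Q₀.mapSurjective hf : Sylow q A) : Subgroup A) = ⊤ :=
      ((Q₀.mapSurjective hf).is_maximal' (hAq.to_subgroup ⊤) le_top).symm
    have h2 : (Q₀ : Subgroup M).map (π.subgroupComap A) = ⊤ := h1
    have h3 := congrArg (Subgroup.map A.subtype) h2
    rw [Subgroup.map_map, ← MonoidHom.range_eq_map, Subgroup.range_subtype] at h3
    rw [hQ, Subgroup.map_map, ← h3]
    rfl
  have hMQ : M ≤ Q ⊔ frattini G := by
    have : (Q.map π).comap π = M := by rw [hQA]
    rw [← this, Subgroup.comap_map_eq, QuotientGroup.ker_mk']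
  have hQn : Q.Normal := by
    rw [← Subgroup.normalizer_eq_top_iff]
    refine frattini_nongenerating (top_le_iff.1 ?_)
    rw [← Q₀.normalizer_sup_eq_top]
    exact sup_le le_sup_left (hMQ.trans (sup_le_sup_right Subgroup.le_normalizer _))
  have hQfr : ¬ Q ≤ frattini G := fun h => hA1 <| by
    rwa [← hQA, Subgroup.map_eq_bot_iff, QuotientGroup.ker_mk']
  obtain ⟨H, hH, hQH⟩ : ∃ H : Subgroup G, IsCoatom H ∧ ¬ Q ≤ H := by
    by_contra! h
    exact hQfr (le_iInf₂ fun H hH => h H hH)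
  refine ⟨q, hq, Q, H, hQn, Q₀.isPGroup'.map _, hH.1, ?_⟩
  exact hH.2 _ (lt_of_le_of_ne le_sup_right fun h => hQH (h ▸ le_sup_left))

/-- In a finite soluble group, `G^(k)` is generated by the `δ_k`-values of prime power order.
With `G = Q H` for a normal `q`-subgroup `Q` and a proper subgroup `H`, a `δ_k`-value of `G` is one
of `H`, covered by induction, times a product of `δ_k`-values in `Q`, which are `q`-elements. -/
theorem derivedSeries_le_closure_isDeltaValue_primePow (k : ℕ) {G : Type*} [Group G] [Finite G]
    [Group.IsSolvable G] :
    derivedSeries G k ≤ Subgroup.closure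
      {g : G | IsDeltaValue k g ∧ ∃ p n : ℕ, p.Prime ∧ orderOf g = p ^ n} := by
  induction hn : Nat.card G using Nat.strong_induction_on generalizing G with
  | _ n ih =>
  subst hn
  cases subsingleton_or_nontrivial G with
  | inl h => exact fun g _ => Subsingleton.elim 1 g ▸ Subgroup.one_mem _
  | inr h =>
  obtain ⟨q, hq, Q, H, hQ, hQq, hH, hQH⟩ := exists_normal_isPGroup_sup_eq_top (G := G)
  have : Fact q.Prime := ⟨hq⟩
  rw [← closure_isDeltaValue, Subgroup.closure_le]
  intro g hg
  obtain ⟨e, he, h, hh, rfl⟩ := IsDeltaValue.exists_mul_of_sup_eq_top hQH hg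
  refine Subgroup.mul_mem _ (Subgroup.closure_mono ?_ he) ?_
  · rintro x ⟨hxQ, hx⟩
    obtain ⟨m, hm⟩ := IsPGroup.iff_orderOf.1 hQq ⟨x, hxQ⟩
    exact ⟨hx, q, m, hq, by rwa [Subgroup.orderOf_mk] at hm⟩
  · have hlt : Nat.card H < Nat.card G :=
      lt_of_le_of_ne (Subgroup.card_le_card_group H) fun h =>
        hH ((Subgroup.card_eq_iff_eq_top H).1 h)
    have := Subgroup.mem_map_of_mem H.subtype (ih _ hlt rfl hh.mem_derivedSeries)
    rw [MonoidHom.map_closure] at this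
    refine Subgroup.closure_mono ?_ this
    rintro _ ⟨x, ⟨hx, p, m, hp, hm⟩, rfl⟩
    exact ⟨hx.map _, p, m, hp, by rw [← hm]; exact Subgroup.orderOf_coe x⟩

/-! ### The coprime order condition -/

section CoprimeCriterion

variable {G : Type*} [Group G]

/-- Since `⁅m, x⁆ * x` is conjugate to `x`, the order of the product can be the product of the
orders only if `⁅m, x⁆ = 1`. -/
theorem commutatorElement_eq_one_of_orderOf_mul [Finite G] {m x : G}
    (h : orderOf (⁅m, x⁆ * x) = orderOf ⁅m, x⁆ * orderOf x) : ⁅m, x⁆ = 1 := by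
  have h1 : orderOf (⁅m, x⁆ * x) = orderOf x := by
    rw [commutatorElement_def, inv_mul_cancel_right]
    exact (MulAut.conj m).orderOf_eq x
  rw [h1] at h
  exact orderOf_eq_one_iff.1 (Nat.eq_of_mul_eq_mul_right (orderOf_pos x) (by rw [← h, one_mul]))

/-- Under the coprime order condition, a `δ_k`-value centralizes every normal subgroup of coprime
order. -/
theorem IsDeltaValue.commute_of_coprime [Finite G] {k : ℕ}
    (h : ∀ a b : G, IsDeltaValue k a → IsDeltaValue k b →
      (orderOf a).Coprime (orderOf b) → orderOf (a * b) = orderOf a * orderOf b)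
    {x : G} (hx : IsDeltaValue k x) {L : Subgroup G} [L.Normal]
    (hL : (Nat.card L).Coprime (orderOf x)) {n : G} (hn : n ∈ L) : Commute n x := by
  set c : ℕ → G := fun j => (fun c => ⁅c, x⁆)^[j] n with hc
  have hc0 : c 0 = n := rfl
  have hcs : ∀ j, c (j + 1) = ⁅c j, x⁆ := fun j => Function.iterate_succ_apply' _ _ _
  have hcL : ∀ j, c j ∈ L := fun j => by
    induction j with
    | zero => exact hn
    | succ j ih =>
      rw [hcs, commutatorElement_def, mul_assoc, mul_assoc, ← mul_assoc x]
      exact L.mul_mem ih (‹L.Normal›.conj_mem _ (L.inv_mem ih) x)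
  have hco : ∀ j, (orderOf (c j)).Coprime (orderOf x) := fun j =>
    hL.coprime_dvd_left (L.orderOf_dvd_natCard (hcL j))
  have hcδ : ∀ j ≤ k + 1, IsDeltaValue j (c j) := fun j hj => by
    induction j with
    | zero => exact isDeltaValue_zero _
    | succ j ih =>
      rw [hcs]
      exact (ih (by omega)).commutatorElement (hx.of_le (by omega))
  have hlast : c (k + 1) = 1 := by
    have h1 := h _ _ (hcδ (k + 1) le_rfl).of_succ hx (hco _)
    rw [hcs] at h1 ⊢
    exact commutatorElement_eq_one_of_orderOf_mul h1
  -- If `c (j + 2) = 1` then `c (j + 1)` commutes with `x`, so that the orders multiply once more.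
  have hdown : ∀ j, c (j + 1) = 1 → c 1 = 1 := fun j => by
    induction j with
    | zero => exact id
    | succ j ih =>
      intro hj
      rw [hcs, commutatorElement_eq_one_iff_commute] at hj
      refine ih ?_
      have h1 := hj.orderOf_mul_eq_mul_orderOf_of_coprime (hco _)
      rw [hcs] at h1 ⊢
      exact commutatorElement_eq_one_of_orderOf_mul h1
  rw [← commutatorElement_eq_one_iff_commute, ← hc0, ← hcs]
  exact hdown k hlast

/-- A subgroup containing a Sylow subgroup of `L` for every prime contains `L`. -/
theorem le_of_forall_exists_sylow_le [Finite G] {L C : Subgroup G}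
    (h : ∀ p : ℕ, p.Prime → ∃ P : Sylow p L, (P : Subgroup L).map L.subtype ≤ C) : L ≤ C := by
  rw [← Subgroup.subgroupOf_eq_top, ← Subgroup.index_eq_one]
  by_contra hne
  obtain ⟨p, hp, hpd⟩ := Nat.exists_prime_and_dvd hne
  have : Fact p.Prime := ⟨hp⟩
  obtain ⟨P, hP⟩ := h p hp
  have h1 : (P : Subgroup L) ≤ C.subgroupOf L := Subgroup.map_le_iff_le_comap.1 hP
  exact P.not_dvd_index (hpd.trans (Subgroup.index_dvd_of_le h1))

variable (G) in
/-- The subgroup generated by the `δ_k`-values of `p`-power order. -/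
def deltaPSubgroup (k p : ℕ) : Subgroup G :=
  Subgroup.closure {g : G | IsDeltaValue k g ∧ ∃ n, orderOf g = p ^ n}

instance (k p : ℕ) : (deltaPSubgroup G k p).Normal :=
  normal_closure_of_conj_mem fun x ⟨hx, n, hn⟩ g => ⟨hx.conj g, n, by
    rw [← hn]; exact (MulAut.conj g).orderOf_eq x⟩

theorem deltaPSubgroup_le (k p : ℕ) : deltaPSubgroup G k p ≤ derivedSeries G k :=
  (Subgroup.closure_le _).2 fun _ hg => hg.1.mem_derivedSeries

/-- If `G^(k+1)` is nilpotent with Sylow `p`-subgroup `P`, the coprime order condition forces every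
`δ_k`-value of `p`-power order to be central in `G^(k)` modulo `P`. -/
theorem commutatorElement_mem_sylow_of_isDeltaValue [Finite G] {k : ℕ}
    (h : ∀ a b : G, IsDeltaValue k a → IsDeltaValue k b →
      (orderOf a).Coprime (orderOf b) → orderOf (a * b) = orderOf a * orderOf b)
    [Group.IsNilpotent (derivedSeries G (k + 1))] {p : ℕ} [Fact p.Prime]
    (P : Sylow p (derivedSeries G (k + 1))) {x : G} (hx : IsDeltaValue k x) {m : ℕ}
    (hm : orderOf x = p ^ m) {n : G} (hn : n ∈ derivedSeries G k) :
    ⁅n, x⁆ ∈ (P : Subgroup _).map (derivedSeries G (k + 1)).subtype := by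
  have hsyl : ∀ (q : ℕ) [Fact q.Prime] (Q : Sylow q (derivedSeries G (k + 1))),
      ((Q : Subgroup _).map (derivedSeries G (k + 1)).subtype).Normal := fun q _ Q => by
    have := Q.characteristic_of_normal inferInstance
    infer_instance
  set E := (P : Subgroup _).map (derivedSeries G (k + 1)).subtype with hE
  have hEn : E.Normal := hsyl p P
  have hcL : ⁅n, x⁆ ∈ derivedSeries G (k + 1) := by
    rw [derivedSeries_succ]
    exact Subgroup.commutator_mem_commutator hn hx.mem_derivedSeries
  -- Modulo `P`, the subgroup `G^(k+1)` centralizes `x`: its Sylow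
  -- `q`-subgroups do, for each prime `q`.
  have hLC : derivedSeries G (k + 1) ≤
      (Subgroup.centralizer {(x : G ⧸ E)}).comap (QuotientGroup.mk' E) := by
    refine le_of_forall_exists_sylow_le fun q hq => ?_
    have : Fact q.Prime := ⟨hq⟩
    by_cases hqp : q = p
    · subst hqp
      refine ⟨P, fun y hy => ?_⟩
      have : (y : G ⧸ E) = 1 := (QuotientGroup.eq_one_iff y).2 hy
      simp [this]
    · obtain ⟨Q⟩ : Nonempty (Sylow q (derivedSeries G (k + 1))) := inferInstance
      refine ⟨Q, fun y hy => ?_⟩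
      have := hsyl q Q
      have hco : (Nat.card ((Q : Subgroup _).map (derivedSeries G (k + 1)).subtype)).Coprime
          (orderOf x) := by
        obtain ⟨j, hj⟩ := IsPGroup.iff_card.1 (Q.isPGroup'.map (derivedSeries G (k + 1)).subtype)
        rw [hj, hm]
        exact Nat.Coprime.pow _ _ ((Nat.coprime_primes hq Fact.out).2 hqp)
      have := (hx.commute_of_coprime h hco hy).map (QuotientGroup.mk' E)
      rw [Subgroup.mem_comap, Subgroup.mem_centralizer_singleton_iff]
      exact this.eq
  have hcomm : Commute (QuotientGroup.mk' E ⁅n, x⁆) (QuotientGroup.mk' E x) := by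
    have := hLC hcL
    rw [Subgroup.mem_comap, Subgroup.mem_centralizer_singleton_iff] at this
    exact this
  have hord : (orderOf (QuotientGroup.mk' E ⁅n, x⁆)).Coprime
      (orderOf (QuotientGroup.mk' E x)) := by
    have h1 : orderOf (QuotientGroup.mk' E x) ∣ p ^ m := hm ▸ orderOf_map_dvd _ x
    have h2 : orderOf (QuotientGroup.mk' E ⁅n, x⁆) ∣
        (P : Subgroup (derivedSeries G (k + 1))).index := by
      rw [orderOf_dvd_iff_pow_eq_one, ← map_pow]
      refine (QuotientGroup.eq_one_iff _).2 ?_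
      exact ⟨⟨⁅n, x⁆, hcL⟩ ^ (P : Subgroup (derivedSeries G (k + 1))).index,
        Subgroup.pow_index_mem _ _, rfl⟩
    refine Nat.Coprime.of_dvd h2 h1 (Nat.Coprime.pow_right _ ?_)
    exact ((Fact.out : p.Prime).coprime_iff_not_dvd.2 P.not_dvd_index).symm
  have := hcomm.orderOf_mul_eq_mul_orderOf_of_coprime hord
  rw [map_commutatorElement] at this
  have := commutatorElement_eq_one_of_orderOf_mul this
  rw [← map_commutatorElement] at this
  exact (QuotientGroup.eq_one_iff (N := E) _).1 this

/-- The subgroup `deltaPSubgroup G k p` is abelian modulo the normal Sylow `p`-subgroup of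
`G^(k+1)`, and its generators are `p`-elements. -/
theorem isPGroup_deltaPSubgroup [Finite G] {k : ℕ}
    (h : ∀ a b : G, IsDeltaValue k a → IsDeltaValue k b →
      (orderOf a).Coprime (orderOf b) → orderOf (a * b) = orderOf a * orderOf b)
    [Group.IsNilpotent (derivedSeries G (k + 1))] {p : ℕ} [Fact p.Prime] :
    IsPGroup p (deltaPSubgroup G k p) := by
  obtain ⟨P⟩ : Nonempty (Sylow p (derivedSeries G (k + 1))) := inferInstance
  set E := (P : Subgroup _).map (derivedSeries G (k + 1)).subtype with hE
  have hEn : E.Normal := by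
    have := P.characteristic_of_normal inferInstance
    infer_instance
  have hEp : IsPGroup p E := P.isPGroup'.map _
  -- Modulo `P` the generators commute, so products of `p`-elements are `p`-elements.
  have hcomm : ∀ x ∈ deltaPSubgroup G k p, ∀ y ∈ deltaPSubgroup G k p,
      Commute (QuotientGroup.mk' E x) (QuotientGroup.mk' E y) := fun x hx y hy => by
    rw [← commutatorElement_eq_one_iff_commute, ← map_commutatorElement]
    refine (QuotientGroup.eq_one_iff _).2 ?_
    refine commutatorElement_mem_of_mem_closure ?_ hx hy
    rintro a ⟨ha, -⟩ b ⟨hb, m, hm⟩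
    exact commutatorElement_mem_sylow_of_isDeltaValue h P hb hm ha.mem_derivedSeries
  have hpow : ∀ x ∈ deltaPSubgroup G k p, ∃ m, QuotientGroup.mk' E x ^ p ^ m = 1 := by
    intro x hx
    induction hx using Subgroup.closure_induction with
    | mem x hx =>
      obtain ⟨-, m, hm⟩ := hx
      exact ⟨m, by rw [← map_pow, ← hm, pow_orderOf_eq_one, map_one]⟩
    | one => exact ⟨0, by simp⟩
    | mul x y hx hy ihx ihy =>
      obtain ⟨i, hi⟩ := ihx
      obtain ⟨j, hj⟩ := ihy
      refine ⟨i + j, ?_⟩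
      rw [map_mul, (hcomm x hx y hy).mul_pow, pow_add, pow_mul, hi, one_pow, mul_comm, pow_mul, hj,
        one_pow, one_mul]
    | inv x _ ih =>
      obtain ⟨m, hm⟩ := ih
      exact ⟨m, by rw [map_inv, inv_pow, hm, inv_one]⟩
  rintro ⟨x, hx⟩
  obtain ⟨m, hm⟩ := hpow x hx
  rw [← map_pow] at hm
  obtain ⟨j, hj⟩ := hEp ⟨x ^ p ^ m, (QuotientGroup.eq_one_iff _).1 hm⟩
  refine ⟨m + j, Subtype.ext ?_⟩
  have := congrArg Subtype.val hj
  simpa [pow_add, pow_mul] using this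

/-- The join of normal `p`-subgroups, one for each prime divisor `p` of the order, is a quotient of
their direct product, as subgroups for distinct primes commute. -/
theorem isNilpotent_iSup_of_isPGroup [Finite G] (T : (Nat.card G).primeFactors → Subgroup G)
    (hn : ∀ p, (T p).Normal) (hp : ∀ p : (Nat.card G).primeFactors, IsPGroup p (T p)) :
    Group.IsNilpotent (⨆ p, T p : Subgroup G) := by
  have hprime : ∀ p : (Nat.card G).primeFactors, Fact (p : ℕ).Prime := fun p =>
    ⟨Nat.prime_of_mem_primeFactors p.2⟩
  have hcomm : Pairwise fun p q => ∀ x y : G, x ∈ T p → y ∈ T q → Commute x y :=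
    fun p q hpq => Subgroup.commute_of_normal_of_disjoint _ _ (hn p) (hn q)
      (IsPGroup.disjoint_of_ne p q (fun h => hpq (Subtype.ext h)) _ _ (hp p) (hp q))
  have := fun p => (hp p).isNilpotent
  rw [← Subgroup.noncommPiCoprod_range (hcomm := hcomm)]
  exact Group.nilpotent_of_surjective _ (MonoidHom.rangeRestrict_surjective _)

/-- The prime power `δ_k`-values generate `G^(k)`, and those belonging to a fixed prime `p` generate
a normal `p`-subgroup. -/
theorem isNilpotent_derivedSeries_of_succ [Finite G] [Group.IsSolvable G] {k : ℕ}
    (h : ∀ a b : G, IsDeltaValue k a → IsDeltaValue k b →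
      (orderOf a).Coprime (orderOf b) → orderOf (a * b) = orderOf a * orderOf b)
    [Group.IsNilpotent (derivedSeries G (k + 1))] :
    Group.IsNilpotent (derivedSeries G k) := by
  have hprime : ∀ p : (Nat.card G).primeFactors, Fact (p : ℕ).Prime := fun p =>
    ⟨Nat.prime_of_mem_primeFactors p.2⟩
  have hsup : ⨆ p : (Nat.card G).primeFactors, deltaPSubgroup G k p = derivedSeries G k := by
    refine le_antisymm (iSup_le fun p => deltaPSubgroup_le k p) ?_
    refine (derivedSeries_le_closure_isDeltaValue_primePow k).trans ?_
    rw [Subgroup.closure_le]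
    rintro g ⟨hg, p, n, hp, hn⟩
    rcases Nat.eq_zero_or_pos n with rfl | hn0
    · rw [pow_zero, orderOf_eq_one_iff] at hn
      exact hn ▸ Subgroup.one_mem _
    · have hpG : p ∈ (Nat.card G).primeFactors := by
        refine Nat.mem_primeFactors.2 ⟨hp, ?_, Nat.card_pos.ne'⟩
        exact (dvd_pow_self p hn0.ne').trans (hn ▸ orderOf_dvd_natCard g)
      exact Subgroup.mem_iSup_of_mem ⟨p, hpG⟩ (Subgroup.subset_closure ⟨hg, n, hn⟩)
  rw [← hsup]
  exact isNilpotent_iSup_of_isPGroup _ (fun p => inferInstance)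
    fun p => isPGroup_deltaPSubgroup h

theorem map_derivedSeries_commutator (k : ℕ) :
    (derivedSeries (commutator G) k).map (commutator G).subtype = derivedSeries G (k + 1) := by
  induction k with
  | zero => rw [derivedSeries_zero, derivedSeries_one, ← MonoidHom.range_eq_map,
      Subgroup.range_subtype]
  | succ k ih => rw [derivedSeries_succ, Subgroup.map_commutator, ih, ← derivedSeries_succ]

/-- Induction along `G' < G`: the coprime order condition passes to `G'`, whose `k`-th derived
subgroup is `G^(k+1)`. -/
theorem isNilpotent_derivedSeries_of_coprime {G : Type*} [Group G] [Finite G] [Group.IsSolvable G]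
    {k : ℕ} (h : ∀ a b : G, IsDeltaValue k a → IsDeltaValue k b →
      (orderOf a).Coprime (orderOf b) → orderOf (a * b) = orderOf a * orderOf b) :
    Group.IsNilpotent (derivedSeries G k) := by
  induction hn : Nat.card G using Nat.strong_induction_on generalizing G with
  | _ n ih =>
  subst hn
  cases subsingleton_or_nontrivial G with
  | inl _ => infer_instance
  | inr _ =>
  have hlt : Nat.card (commutator G) < Nat.card G :=
    lt_of_le_of_ne (Subgroup.card_le_card_group _) fun h =>
      (Group.IsSolvable.commutator_lt_top_of_nontrivial G).ne ((Subgroup.card_eq_iff_eq_top _).1 h)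
  have h1 : Group.IsNilpotent (derivedSeries (commutator G) k) := by
    refine ih _ hlt (fun a b ha hb hab => ?_) rfl
    rw [← Subgroup.orderOf_coe a, ← Subgroup.orderOf_coe b] at hab ⊢
    rw [← Subgroup.orderOf_coe, Subgroup.coe_mul]
    exact h a b (ha.map (commutator G).subtype) (hb.map (commutator G).subtype) hab
  have h2 : Group.IsNilpotent (derivedSeries G (k + 1)) := by
    rw [← map_derivedSeries_commutator]
    exact Group.nilpotent_of_mulEquiv
      ((derivedSeries (commutator G) k).equivMapOfInjective _ (commutator G).subtype_injective)
  exact isNilpotent_derivedSeries_of_succ h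

end CoprimeCriterion

/-! ### Coprime elements of nilpotent groups -/

/-- In a finite nilpotent group, the product of its Sylow subgroups, elements of coprime orders
commute. -/
theorem commute_of_coprime_orderOf_of_isNilpotent {N : Type*} [Group N] [Finite N]
    [Group.IsNilpotent N] {a b : N} (hab : (orderOf a).Coprime (orderOf b)) : Commute a b := by
  obtain ⟨e⟩ := ((Group.isNilpotent_of_finite_tfae (G := N)).out 0 4).1 ‹_›
  have hcop : ∀ c : N, ∀ p P, orderOf (e.symm c p P) ∣ orderOf c := fun c p P => by
    rw [orderOf_dvd_iff_pow_eq_one, ← Pi.pow_apply, ← Pi.pow_apply, ← map_pow, pow_orderOf_eq_one,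
      map_one]
    rfl
  refine e.symm.injective ?_
  rw [map_mul, map_mul]
  funext p P
  have hp : Fact (p : ℕ).Prime := ⟨Nat.prime_of_mem_primeFactors p.2⟩
  obtain ⟨i, hi⟩ := IsPGroup.iff_orderOf.1 P.isPGroup' (e.symm a p P)
  obtain ⟨j, hj⟩ := IsPGroup.iff_orderOf.1 P.isPGroup' (e.symm b p P)
  have h1 : (orderOf (e.symm a p P)).Coprime (orderOf (e.symm b p P)) :=
    Nat.Coprime.of_dvd (hcop a p P) (hcop b p P) hab
  -- Two coprime powers of `p` cannot both be nontrivial.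
  rcases Nat.eq_zero_or_pos i with rfl | hi0
  · have h2 : e.symm a p P = 1 := by rwa [pow_zero, orderOf_eq_one_iff] at hi
    change e.symm a p P * e.symm b p P = e.symm b p P * e.symm a p P
    rw [h2, one_mul, mul_one]
  · rcases Nat.eq_zero_or_pos j with rfl | hj0
    · have h2 : e.symm b p P = 1 := by rwa [pow_zero, orderOf_eq_one_iff] at hj
      change e.symm a p P * e.symm b p P = e.symm b p P * e.symm a p P
      rw [h2, one_mul, mul_one]
    · rw [hi, hj, Nat.coprime_pow_left_iff hi0, Nat.coprime_pow_right_iff hj0,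
        Nat.coprime_self] at h1
      exact absurd h1 hp.out.ne_one

theorem theorem1p1 {G : Type*} [Group G] [Finite G] [Group.IsSolvable G] (k : ℕ) :
    Group.IsNilpotent (derivedSeries G k) ↔
      ∀ a b : G, IsDeltaValue k a → IsDeltaValue k b →
        (orderOf a).Coprime (orderOf b) → orderOf (a * b) = orderOf a * orderOf b := by
  refine ⟨fun _ a b ha hb hab => ?_, isNilpotent_derivedSeries_of_coprime⟩
  have hc : Commute (⟨a, ha.mem_derivedSeries⟩ : derivedSeries G k) ⟨b, hb.mem_derivedSeries⟩ :=
    commute_of_coprime_orderOf_of_isNilpotent (by simpa only [Subgroup.orderOf_mk] using hab)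
  exact (hc.map (derivedSeries G k).subtype).orderOf_mul_eq_mul_orderOf_of_coprime hab
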